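/- Let $n\ge 1$ and let $n\Delta_2$ be an equilateral triangle of side length $n$, with one side horizontal at the bottom, divided into its grid of unit equilateral triangles. A \emph{lozenge tiling} of $n\Delta_2$ is a subdivision of $n\Delta_2$ into upward unit triangles and unit rhombi of the grid (a unit rhombus being the union of two unit triangles that share an edge); it contains exactly $n$ triangles. Number the triangles of a lozenge tiling by $1,\dots,n$. Color $i$ starts in the center of triangle $i$, leaves it through its three sides, and, whenever it enters a rhombus through a side, leaves it through the opposite side, until it reaches the boundary of $n\Delta_2$. Each of the $n$ unit edges on each side of $n\Delta_2$ is reached by exactly one color, and the colors read along each of the three sides in clockwise direction form three permutations of $[n]$, called the \emph{system of permutations} of the (numbered) tiling. A \emph{system of permutations} on the edges of $n\Delta_2$ is a triple $\sigma$ of permutations of $[n]=\{1,\dots,n\}$, one on each side of $n\Delta_2$, each read in clockwise direction. It is \emph{acyclic} if there are no $i\ne j$ in $[n]$ such that $i$ appears before $j$ in all three permutations. \textbf{Theorem (2-D Acyclic System Theorem).} Let $\sigma$ be a system of permutations on the edges of the triangle $n\Delta_2$. Then $\sigma$ is the system of permutations of some lozenge tiling of $n\Delta_2$, for some numbering of its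 triangles, if and only if $\sigma$ is acyclic. -/

import Mathlib

/-! The triangle `nΔ₂` is used in barycentric coordinates: it is the set of nonnegative `x : Fin 3 → ℝ`
with coordinate sum `n`, and its unit triangular grid has the points of `Fin 3 → ℕ` of coordinate
sum `n` as vertices. The corners `n • w 0`, `n • w 1`, `n • w 2` are the lower left, the top and
the lower right corner, so `0 → 1 → 2 → 0` is the clockwise direction. -/

namespace Lozenge

/-- The vertices of `Δ₂` (standard basis vectors). -/
def w (a : Fin 3) : Fin 3 → ℕ := Pi.single a 1

/-- The unit triangles of the triangular grid.
`up q` is the upward triangle with the three vertices `q + w a`, that is, `q + Δ₂`;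
`down r` is the downward triangle with the three vertices `r + w a + w b`, `a ≠ b`. -/
inductive UnitTriangle : Type
  | up (q : Fin 3 → ℕ)
  | down (r : Fin 3 → ℕ)

/-- The unit triangles of the grid that are contained in `nΔ₂`: those whose vertices have
coordinate sum `n`. -/
def UnitTriangle.Inside (n : ℕ) : UnitTriangle → Prop
  | .up q => ∑ a, q a + 1 = n
  | .down r => ∑ a, r a + 2 = n

/-- The tiles: upward unit triangles, and unit rhombi in three orientations.
`rhombus r a` is the union of `down r` and the upward triangle `up (r + w a)` adjacent to it. Its
vertices are `r + 2 w a`, `r + w a + w b`, `r + w a + w c` and `r + w b + w c`, where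
`{a, b, c} = {0, 1, 2}`. -/
inductive Tile : Type
  | triangle (q : Fin 3 → ℕ)
  | rhombus (r : Fin 3 → ℕ) (a : Fin 3)

/-- The unit triangles that make up a tile. -/
def Tile.cells : Tile → Set UnitTriangle
  | .triangle q => {.up q}
  | .rhombus r a => {.down r, .up (r + w a)}

/-- A lozenge tiling of `nΔ₂`: a set of tiles contained in `nΔ₂` which cover every unit triangle of
`nΔ₂` exactly once. -/
structure LozengeTiling (n : ℕ) where
  tiles : Set Tile
  inside : ∀ t ∈ tiles, ∀ c ∈ t.cells, c.Inside n
  covers : ∀ c : UnitTriangle, c.Inside n → ∃! t, t ∈ tiles ∧ c ∈ t.cells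

/-- The unit edges of the grid. Each of them is a side of exactly one upward triangle of the grid;
`⟨q, a⟩` is the side of `up q` opposite to the vertex `q + w a`, that is, the edge with the two
endpoints `q + w b`, `b ≠ a`. -/
structure Edge : Type where
  base : Fin 3 → ℕ
  opp : Fin 3

/-- `t.Opposite e f`: the tile `t` is a rhombus and `e`, `f` are opposite sides of it. The sides of
`rhombus r a` are, for each `b ≠ a`, the two opposite (parallel) sides `⟨r + w a, b⟩` (a side
of its upper half `up (r + w a)`) and `⟨r + w b, b⟩` (a side of its lower half `down r`); the edge
`⟨r + w a, a⟩` is its short diagonal. -/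
def Tile.Opposite : Tile → Edge → Edge → Prop
  | .triangle _, _, _ => False
  | .rhombus r a, e, f => ∃ b, b ≠ a ∧
      ((e = ⟨r + w a, b⟩ ∧ f = ⟨r + w b, b⟩) ∨ (e = ⟨r + w b, b⟩ ∧ f = ⟨r + w a, b⟩))

/-- A numbering by `Fin n` of the triangles of a lozenge tiling. -/
abbrev LozengeTiling.Numbering {n : ℕ} (T : LozengeTiling n) : Type :=
  Fin n ≃ {q : Fin 3 → ℕ // Tile.triangle q ∈ T.tiles}

/-- The colored dual of a lozenge tiling with numbered triangles: `T.HasColor ν e i` means that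
color `i` crosses the edge `e`. Color `i` starts in the center of the `i`-th triangle, leaves it
through its three sides, and, whenever it enters a rhombus through a side, it
crosses the rhombus and leaves it through the opposite side. -/
inductive LozengeTiling.HasColor {n : ℕ} (T : LozengeTiling n) (ν : T.Numbering) :
    Edge → Fin n → Prop
  | center (i : Fin n) (a : Fin 3) : T.HasColor ν ⟨(ν i).1, a⟩ i
  | spread {t : Tile} {e f : Edge} {i : Fin n} (ht : t ∈ T.tiles) (hef : t.Opposite e f)
      (he : T.HasColor ν e i) : T.HasColor ν f i

/-- The `k`-th unit edge (`k = 0, …, n - 1`) on the side of `nΔ₂` that goes clockwise from the corner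
`n • w s` to the corner `n • w (s + 1)`. Its endpoints are `(n - k) w s + k w (s + 1)` and
`(n - k - 1) w s + (k + 1) w (s + 1)`. -/
def sideEdge {n : ℕ} (s : Fin 3) (k : Fin n) : Edge :=
  ⟨(n - 1 - (k : ℕ)) • w s + (k : ℕ) • w (s + 1), s + 2⟩

/-- A system of permutations on the edges of the triangle `nΔ₂`: `σ s` is the permutation
on the side from `n • w s` to `n • w (s + 1)`, and `σ s k` is its `k`-th letter when it is read in
clockwise direction. -/
abbrev PermSystem (n : ℕ) : Type := Fin 3 → Equiv.Perm (Fin n)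

/-- `σ` is the system of permutations of the tiling `T` with numbered triangles: the restriction of
the colored dual to the three sides of `nΔ₂`, each read in clockwise direction. -/
def LozengeTiling.IsSystem {n : ℕ} (T : LozengeTiling n) (ν : T.Numbering) (σ : PermSystem n) :
    Prop :=
  ∀ (s : Fin 3) (k : Fin n), T.HasColor ν (sideEdge s k) (σ s k)

/-- `σ` is the system of permutations of some lozenge tiling, for some numbering of its triangles. -/
def PermSystem.Achievable {n : ℕ} (σ : PermSystem n) : Prop :=
  ∃ (T : LozengeTiling n) (ν : T.Numbering), T.IsSystem ν σ

/-- No two letters `i`, `j` appear in the form `…i…j…` in all three permutations, read clockwise. -/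
def PermSystem.Acyclic {n : ℕ} (σ : PermSystem n) : Prop :=
  ¬ ∃ i j : Fin n, i ≠ j ∧ ∀ s : Fin 3, (σ s).symm i < (σ s).symm j

end Lozenge

namespace Lozenge

/-! Necessity: the three legs of a color run from its triangle to the three sides. Legs towards the
same side never cross, because two of them could only change order at a downward cell covered by two
rhombi. By `Leg.compare`, the order of two colors on one side therefore gives inequalities between
the barycentric coordinates of their triangles. The alternatives obtained from the same order on all
three sides are incompatible.

Sufficiency: sweep a lattice path from the bottom side up to the other two sides. Passing a rhombus
exchanges two consecutive colored steps; passing a triangle splits a horizontal step into one step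
up and one down of the same color. It thus suffices to transform the bottom word into the word of
the left and right sides, which `sweeps_aux` does greedily. Colors are split in the order of the
left side. Before `j` is split, the right-side steps preceding it whose color belongs after `j` are
moved past it; afterwards its left-side step is moved to the front. Any horizontal step of color `m`
still before `j` must not come later on the right side, and acyclicity ensures this, since `m`
follows `j` on the left and bottom sides.

`Sweep.exists_tiles` turns moves into tiles: `SweepCovers` keeps the region below the path tiled,
and `SweepColors` keeps strips of rhombi between steps, triangles and bottom edges. -/

theorem w_apply (a c : Fin 3) : w a c = if c = a then 1 else 0 := Pi.single_apply a 1 c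

theorem LozengeTiling.tile_unique {n : ℕ} (T : LozengeTiling n) {t t' : Tile} {c : UnitTriangle}
    (ht : t ∈ T.tiles) (ht' : t' ∈ T.tiles) (hc : c ∈ t.cells) (hc' : c ∈ t'.cells) : t = t' :=
  (T.covers c (T.inside t ht c hc)).unique ⟨ht, hc⟩ ⟨ht', hc'⟩

/-! ### Legs of colors, and necessity of acyclicity -/

/-- `T.Leg b p q`: the leg of the triangle `p` towards the side `x b = 0` crosses the edge
`⟨q, b⟩`. -/
inductive LozengeTiling.Leg {n : ℕ} (T : LozengeTiling n) (b : Fin 3) (p : Fin 3 → ℕ) :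
    (Fin 3 → ℕ) → Prop
  | refl (hp : Tile.triangle p ∈ T.tiles) : T.Leg b p p
  | step {r : Fin 3 → ℕ} {a : Fin 3} (ht : Tile.rhombus r a ∈ T.tiles) (hab : a ≠ b)
      (h : T.Leg b p (r + w b)) : T.Leg b p (r + w a)

/-- `HasColor` may cross a rhombus in both directions, while `Leg` only moves away from its
triangle. A backward crossing undoes the last step, since an upward cell lies in a single tile. -/
theorem LozengeTiling.Leg.previous {n : ℕ} {T : LozengeTiling n} {b : Fin 3} {p q : Fin 3 → ℕ}
    (h : T.Leg b p q) {r : Fin 3 → ℕ} {a : Fin 3} (ht : Tile.rhombus r a ∈ T.tiles)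
    (hq : q = r + w a) : T.Leg b p (r + w b) := by
  cases h with
  | refl hp =>
    have := T.tile_unique (c := .up p) hp ht (by simp [Tile.cells]) (by simp [Tile.cells, hq])
    cases this
  | step ht' hab h =>
    have := T.tile_unique (c := .up (r + w a)) ht' ht (by simp [Tile.cells, hq])
      (by simp [Tile.cells])
    cases this
    exact h

theorem LozengeTiling.HasColor.leg {n : ℕ} {T : LozengeTiling n} {ν : T.Numbering} {e : Edge}
    {i : Fin n} (h : T.HasColor ν e i) : T.Leg e.opp (ν i).1 e.base := by
  induction h with
  | center i a => exact .refl (ν i).2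
  | @spread t e f i ht hef he ih =>
    cases t with
    | triangle q => exact hef.elim
    | rhombus r a =>
      obtain ⟨b, hb, ⟨rfl, rfl⟩ | ⟨rfl, rfl⟩⟩ := hef
      · exact ih.previous ht rfl
      · exact .step ht hb.symm ih

/-- Each step trades one unit of the coordinate `b` for one unit of another coordinate. -/
theorem LozengeTiling.Leg.bounds {n : ℕ} {T : LozengeTiling n} {b : Fin 3} {p q : Fin 3 → ℕ}
    (h : T.Leg b p q) : q b ≤ p b ∧ ∀ a, a ≠ b → p a ≤ q a := by
  induction h with
  | refl hp => exact ⟨le_rfl, fun _ _ => le_rfl⟩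
  | @step r a ht hab h ih =>
    obtain ⟨h1, h2⟩ := ih
    constructor
    · simp [w_apply, hab.symm] at h1 ⊢
      omega
    · intro c hc
      have := h2 c hc
      simp [w_apply, hc] at this ⊢
      omega

/-- Two legs towards the same side do not cross; this compares the positions of the two triangles
that they start from. -/
theorem LozengeTiling.Leg.compare {n : ℕ} {T : LozengeTiling n} {b : Fin 3} {p p' q q' : Fin 3 → ℕ}
    (h : T.Leg b p q) (h' : T.Leg b p' q') (hb : q b = q' b)
    (hsum : q b + q (b + 1) + q (b + 2) = q' b + q' (b + 1) + q' (b + 2))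
    (hlt : q (b + 2) < q' (b + 2)) :
    (p b ≤ p' b ∧ p' (b + 1) < p (b + 1)) ∨ (p' b ≤ p b ∧ p (b + 2) < p' (b + 2)) := by
  have hb1 : b + 1 ≠ b := by fin_cases b <;> decide
  have hb2 : b + 2 ≠ b := by fin_cases b <;> decide
  induction h generalizing q' with
  -- The first leg starts at this level, so `p = q`, and the bounds for the second leg decide.
  | refl hp =>
    have h1 := h'.bounds.1
    have h2 := h'.bounds.2 _ hb1
    left
    constructor <;> omega
  | @step r a ht hab h ih =>
    have h0 := (LozengeTiling.Leg.step ht hab h).bounds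
    cases h' with
    | refl hp' =>
      have h1 := h0.1
      have h2 := h0.2 _ hb2
      right
      constructor <;> omega
    | @step r' a' ht' hab' h' =>
      -- Going back one level could spoil the strict order only if both legs came through the same
      -- downward cell by different rhombi.
      have hne : ¬ (r = r' ∧ a ≠ a') := by
        rintro ⟨rfl, hne⟩
        have := T.tile_unique (c := .down r) ht ht' (by simp [Tile.cells]) (by simp [Tile.cells])
        cases this
        exact hne rfl
      have hr : r = r' ↔ r b = r' b ∧ r (b + 1) = r' (b + 1) ∧ r (b + 2) = r' (b + 2) := by
        constructor
        · rintro rfl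
          simp
        · rintro ⟨h1, h2, h3⟩
          funext c
          fin_cases b <;> fin_cases c <;> assumption
      rw [hr] at hne
      refine ih h' ?_ ?_ ?_ <;>
      · revert hb hsum hlt hne hab hab'
        clear * -
        simp only [Pi.add_apply, w_apply]
        fin_cases b <;> fin_cases a <;> fin_cases a' <;> simp <;> omega

theorem PermSystem.Achievable.acyclic {n : ℕ} {σ : PermSystem n} (h : σ.Achievable) :
    σ.Acyclic := by
  obtain ⟨T, ν, hσ⟩ := h
  rintro ⟨i, j, -, hij⟩
  have key : ∀ s : Fin 3, ∀ i, T.Leg (s + 2) (ν i).1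
      ((n - 1 - ((σ s).symm i : ℕ)) • w s + ((σ s).symm i : ℕ) • w (s + 1)) := by
    intro s i
    have := (hσ s ((σ s).symm i)).leg
    simpa [sideEdge] using this
  have h0 := (key 0 i).compare (key 0 j)
  have h1 := (key 1 i).compare (key 1 j)
  have h2 := (key 2 i).compare (key 2 j)
  have l0 := Fin.lt_def.1 (hij 0)
  have l1 := Fin.lt_def.1 (hij 1)
  have l2 := Fin.lt_def.1 (hij 2)
  have u0 := ((σ 0).symm j).2
  have u1 := ((σ 1).symm j).2
  have u2 := ((σ 2).symm j).2
  generalize ((σ 0).symm i : ℕ) = a0 at *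
  generalize ((σ 1).symm i : ℕ) = a1 at *
  generalize ((σ 2).symm i : ℕ) = a2 at *
  generalize ((σ 0).symm j : ℕ) = c0 at *
  generalize ((σ 1).symm j : ℕ) = c1 at *
  generalize ((σ 2).symm j : ℕ) = c2 at *
  simp [w_apply] at h0 h1 h2
  have := h0 (by omega) l0
  have := h1 (by omega) l1
  have := h2 (by omega) l2
  -- Each side offers two alternatives; each of the eight combinations contains a pair of opposite
  -- inequalities.
  omega

/-! ### Sweeping as rewriting of words -/

/-- Elementary moves of a sweeping path. A path is a word of letters `(b, i)`, a step along an edge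
opposite to `b` of color `i`. A rhombus exchanges two adjacent letters, a triangle splits a
horizontal one. -/
inductive Sweep {n : ℕ} : List (Fin 3 × Fin n) → List (Fin 3 × Fin n) → Prop
  | rhombus (A B : List (Fin 3 × Fin n)) {a b : Fin 3} (i j : Fin n) (hab : a < b) :
      Sweep (A ++ (a, i) :: (b, j) :: B) (A ++ (b, j) :: (a, i) :: B)
  | triangle (A B : List (Fin 3 × Fin n)) (i : Fin n) :
      Sweep (A ++ (1, i) :: B) (A ++ (2, i) :: (0, i) :: B)

/-- A sequence of elementary moves. -/
abbrev Sweeps {n : ℕ} : List (Fin 3 × Fin n) → List (Fin 3 × Fin n) → Prop :=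
  Relation.ReflTransGen Sweep

theorem Sweeps.append_left {n : ℕ} {W W' : List (Fin 3 × Fin n)} (h : Sweeps W W')
    (C : List (Fin 3 × Fin n)) : Sweeps (C ++ W) (C ++ W') := by
  refine Relation.ReflTransGen.lift (C ++ ·) ?_ _ _ h
  intro U V hUV
  cases hUV with
  | rhombus A B i j hab => simpa using Sweep.rhombus (C ++ A) B i j hab
  | triangle A B i => simpa using Sweep.triangle (C ++ A) B i

/-- A letter passes to the right through a block of letters of larger kind. -/
theorem sweeps_pass_right {n : ℕ} (a : Fin 3) (i : Fin n) (A B : List (Fin 3 × Fin n))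
    (hA : ∀ y ∈ A, a < y.1) : Sweeps ((a, i) :: (A ++ B)) (A ++ (a, i) :: B) := by
  induction A with
  | nil => exact .refl
  | cons y A ih =>
    refine .head (Sweep.rhombus [] (A ++ B) i y.2 (hA y (by simp))) ?_
    exact (ih fun z hz => hA z (by simp [hz])).append_left [y]

/-- A letter passes to the left through a block of letters of smaller kind. -/
theorem sweeps_pass_left {n : ℕ} (b : Fin 3) (j : Fin n) (A B : List (Fin 3 × Fin n))
    (hA : ∀ y ∈ A, y.1 < b) : Sweeps (A ++ (b, j) :: B) ((b, j) :: (A ++ B)) := by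
  induction A with
  | nil => exact .refl
  | cons y A ih =>
    refine ((ih fun z hz => hA z (by simp [hz])).append_left [y]).trans ?_
    exact .single (Sweep.rhombus [] (A ++ B) y.2 j (hA y (by simp)))

/-- A selected step has kind 0, and every unselected step after it in `A` has kind 1, as does `(1,
j)`; so all the exchanges needed are allowed. -/
theorem sweeps_filter {n : ℕ} (p : Fin 3 × Fin n → Bool) (j : Fin n) (A B : List (Fin 3 × Fin n))
    (hp : ∀ y ∈ A, p y → y.1 = 0)
    (hA : A.Pairwise fun y z => p y → p z ∨ z.1 = 1) :
    Sweeps (A ++ (1, j) :: B)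
      (A.filter (fun y => !p y) ++ (1, j) :: (A.filter p ++ B)) := by
  induction A with
  | nil => exact .refl
  | cons y A ih =>
    rw [List.pairwise_cons] at hA
    refine ((ih (fun z hz => hp z (by simp [hz])) hA.2).append_left [y]).trans ?_
    by_cases hy : p y
    · have h0 := hp y (by simp) hy
      obtain ⟨a, i⟩ := y
      dsimp only at h0
      subst h0
      have := sweeps_pass_right 0 i (A.filter (fun y => !p y) ++ [(1, j)]) (A.filter p ++ B) ?_
      · simpa [hy] using this
      · intro z hz
        rw [List.mem_append, List.mem_singleton, List.mem_filter] at hz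
        rcases hz with ⟨hz, hpz⟩ | rfl
        · rcases hA.1 z hz hy with h | h
          · simp [h] at hpz
          · simp [h]
        · simp
    · simpa [hy] using Relation.ReflTransGen.refl

/-- The condition on letters `x` before `y` maintained by the sweep: right edges come after smaller
letters of `σ 1`, and bottom edges are in the order of the bottom side. -/
def PermSystem.Ordered {n : ℕ} (σ : PermSystem n) (x y : Fin 3 × Fin n) : Prop :=
  (y.1 = 0 → (σ 1).symm x.2 ≤ (σ 1).symm y.2) ∧
    (x.1 = 1 → y.1 = 1 → (σ 2).symm y.2 < (σ 2).symm x.2)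

/-- The colors of the letters of a word that are not parallel to the left side. -/
def rightColors {n : ℕ} (W : List (Fin 3 × Fin n)) : List (Fin n) :=
  (W.filter (·.1 ≠ 2)).map Prod.snd

theorem rightColors_append {n : ℕ} (W W' : List (Fin 3 × Fin n)) :
    rightColors (W ++ W') = rightColors W ++ rightColors W' := by
  simp [rightColors]

theorem rightColors_map_two {n : ℕ} (V : List (Fin n)) : rightColors (V.map (Prod.mk 2)) = [] := by
  simp [rightColors]

theorem rightColors_map {n : ℕ} (V : List (Fin n)) {b : Fin 3} (hb : b ≠ 2) :
    rightColors (V.map (Prod.mk b)) = V := by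
  induction V with
  | nil => rfl
  | cons i V ih => simpa [rightColors, hb] using ih

/-- A split replaces a letter of kind 1 by one of kind 0 with the same color, and the new letter of
kind 2 is not counted. -/
theorem Sweep.rightColors_perm {n : ℕ} {W W' : List (Fin 3 × Fin n)} (h : Sweep W W') :
    (rightColors W).Perm (rightColors W') := by
  cases h with
  | rhombus A B i j hab =>
    exact (((List.Perm.swap _ _ _).append_left A).filter _).map _
  | triangle A B i => simp [rightColors]

theorem Sweeps.rightColors_perm {n : ℕ} {W W' : List (Fin 3 × Fin n)} (h : Sweeps W W') :
    (rightColors W).Perm (rightColors W') := by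
  induction h with
  | refl => exact .refl _
  | tail _ h ih => exact ih.trans h.rightColors_perm

/-- Here `U` is the path without its finished part along the left side, and `todo` lists the colors
not yet split. The order of `V` is only weak because the invariant does not record that colors are
distinct; `rightColors` supplies this later. -/
theorem PermSystem.Acyclic.sweeps_aux {n : ℕ} {σ : PermSystem n} (hσ : σ.Acyclic)
    (todo : List (Fin n)) (U : List (Fin 3 × Fin n))
    (htodo : todo.Pairwise fun i j => (σ 0).symm i < (σ 0).symm j)
    (hU2 : ∀ x ∈ U, x.1 < 2)
    (hmem : ∀ m, (1, m) ∈ U ↔ m ∈ todo) (hU : U.Pairwise σ.Ordered) :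
    ∃ V : List (Fin n), V.Pairwise (fun i j => (σ 1).symm i ≤ (σ 1).symm j) ∧
      Sweeps U (todo.map (Prod.mk 2) ++ V.map (Prod.mk 0)) := by
  induction todo generalizing U with
  | nil =>
    have h0 : ∀ x ∈ U, x.1 = 0 := by
      rintro ⟨a, i⟩ hx
      have h2 := hU2 _ hx
      have h1 : a ≠ 1 := by
        rintro rfl
        simpa using (hmem i).1 hx
      dsimp only at *
      omega
    refine ⟨U.map Prod.snd, ?_, ?_⟩
    · rw [List.pairwise_map]
      refine hU.imp_of_mem ?_
      intro x y _ hy hxy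
      exact hxy.1 (h0 y hy)
    · have : U = (U.map Prod.snd).map (Prod.mk 0) := by
        rw [List.map_map]
        conv_lhs => rw [← List.map_id U]
        refine List.map_congr_left fun x hx => ?_
        exact Prod.ext (h0 x hx) rfl
      simpa [← this] using Relation.ReflTransGen.refl
  | cons j todo ih =>
    rw [List.pairwise_cons] at htodo
    obtain ⟨A, B, rfl⟩ := List.append_of_mem ((hmem j).2 (by simp))
    -- Steps of kind 0 cannot be exchanged with each other, so those that belong after `(0, j)` must
    -- pass `(1, j)` before it splits.
    set p : Fin 3 × Fin n → Bool := fun y => y.1 = 0 ∧ (σ 1).symm j < (σ 1).symm y.2 with hp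
    rw [List.pairwise_append, List.pairwise_cons] at hU
    obtain ⟨hA, ⟨hjB, hB⟩, hAB⟩ := hU
    have hlt : ∀ m, (1, m) ∈ A → (σ 1).symm m ≤ (σ 1).symm j := by
      intro m hm
      have h1 := (hAB _ hm (1, j) (by simp)).2 rfl rfl
      dsimp only at h1
      have hmj : m ≠ j := by
        rintro rfl
        exact lt_irrefl _ h1
      have h2 : m ∈ todo := by
        have := (hmem m).1 (by simp [hm])
        simpa [hmj] using this
      by_contra! h3
      -- The order on the left side holds as `m` is still to be split; on the bottom it holds as the
      -- word reads that side counterclockwise.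
      refine hσ ⟨j, m, hmj.symm, fun s => ?_⟩
      fin_cases s
      · exact htodo.1 m h2
      · exact h3
      · exact h1
    have h01 : ∀ x ∈ A, x.1 = 0 ∨ x.1 = 1 := by
      intro x hx
      have := hU2 x (by simp [hx])
      omega
    refine Exists.imp ?_ (ih (A.filter (fun y => !p y) ++ (0, j) :: (A.filter p ++ B)) htodo.2
      ?_ ?_ ?_)
    · rintro V ⟨hV, hUV⟩
      refine ⟨hV, ?_⟩
      refine (sweeps_filter p j A B ?_ ?_).trans ?_
      · intro y _ hy
        simp only [hp, decide_eq_true_eq] at hy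
        exact hy.1
      · refine hA.imp_of_mem ?_
        intro y z _ hz hyz hy
        simp only [hp, decide_eq_true_eq] at hy ⊢
        rcases h01 z hz with h | h
        · left
          refine ⟨h, hy.2.trans_le (hyz.1 h)⟩
        · exact .inr h
      · refine .head (Sweep.triangle _ _ j) ?_
        refine (sweeps_pass_left 2 j _ _ ?_).trans ?_
        · intro y hy
          exact hU2 y (by simp [List.mem_of_mem_filter hy])
        · exact hUV.append_left [(2, j)]
    · intro x hx
      simp only [List.mem_append, List.mem_cons, List.mem_filter] at hx
      rcases hx with hx | rfl | hx | hx
      · exact hU2 x (by simp [hx.1])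
      · simp
      · exact hU2 x (by simp [hx.1])
      · exact hU2 x (by simp [hx])
    · intro m
      have hm := hmem m
      by_cases hmj : m = j
      · subst hmj
        have h1 : m ∉ todo := fun h => lt_irrefl _ (htodo.1 m h)
        have h2 : (1, m) ∉ A := fun h => lt_irrefl _ ((hAB _ h (1, m) (by simp)).2 rfl rfl)
        have h3 : (1, m) ∉ B := fun h => lt_irrefl _ ((hjB _ h).2 rfl rfl)
        simp [h1, h2, h3]
      · simp [hmj] at hm
        simp [hp, hm]
    · have hp0 : ∀ y ∈ A, p y → y.1 = 0 ∧ (σ 1).symm j < (σ 1).symm y.2 := by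
        intro y _ hy
        simpa [hp] using hy
      have hle : ∀ y ∈ A, ¬ p y → (σ 1).symm y.2 ≤ (σ 1).symm j := by
        rintro ⟨a, m⟩ hy hpy
        rcases h01 _ hy with h | h
        · exact not_lt.1 fun hlt => hpy (by simpa [hp, hlt] using h)
        · dsimp only at h
          subst h
          exact hlt m hy
      rw [List.pairwise_append, List.pairwise_cons, List.pairwise_append]
      refine ⟨hA.filter _, ⟨?_, hA.filter _, hB, ?_⟩, ?_⟩
      · intro y hy
        refine ⟨fun h => ?_, fun h => by simp at h⟩
        rw [List.mem_append, List.mem_filter] at hy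
        rcases hy with hy | hy
        · exact (hp0 y hy.1 hy.2).2.le
        · exact (hjB y hy).1 h
      · intro x hx y hy
        exact hAB x (List.mem_of_mem_filter hx) y (by simp [hy])
      · intro x hx y hy
        rw [List.mem_filter] at hx
        have hxj := hle x hx.1 (by simpa using hx.2)
        rw [List.mem_cons, List.mem_append, List.mem_filter] at hy
        rcases hy with rfl | hy | hy
        · exact ⟨fun _ => hxj, fun _ h => by simp at h⟩
        · have := hp0 y hy.1 hy.2
          exact ⟨fun _ => (hxj.trans this.2.le), fun _ h => by simp [this.1] at h⟩
        · exact hAB x hx.1 y (by simp [hy])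

/-- For an acyclic system, the bottom side can be swept to the other two sides. -/
theorem PermSystem.Acyclic.sweeps {n : ℕ} {σ : PermSystem n} (hσ : σ.Acyclic) :
    Sweeps ((List.ofFn (σ 2)).reverse.map (Prod.mk 1))
      ((List.ofFn (σ 0)).map (Prod.mk 2) ++ (List.ofFn (σ 1)).map (Prod.mk 0)) := by
  obtain ⟨V, hV, h⟩ := hσ.sweeps_aux (List.ofFn (σ 0))
    ((List.ofFn (σ 2)).reverse.map (Prod.mk 1))
    (by simp [List.pairwise_ofFn]) (by simp) (by simp [List.mem_ofFn, (σ _).surjective _])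
    (by simp [List.pairwise_reverse, List.pairwise_ofFn, Ordered])
  have hperm : (rightColors ((List.ofFn (σ 2)).reverse.map (Prod.mk (1 : Fin 3)))).Perm V := by
    have := h.rightColors_perm
    rwa [rightColors_append, rightColors_map_two, rightColors_map V (by decide),
      List.nil_append] at this
  -- Two lists sorted by position on the right side, each a permutation of all colors, coincide.
  have : V = List.ofFn (σ 1) := by
    refine List.Perm.eq_of_pairwise (fun i j _ _ hij hji => ?_) hV ?_ (hperm.symm.trans ?_)
    · exact (σ 1).symm.injective (le_antisymm hij hji)
    · rw [List.pairwise_ofFn]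
      intro i j hij
      simpa using hij.le
    · rw [rightColors_map _ (by decide)]
      exact (List.reverse_perm _).trans
        (((σ 2).ofFn_comp_perm id).trans ((σ 1).ofFn_comp_perm id).symm)
  rwa [this] at h

/-! ### Vertices and edges of a path in coordinates -/

/-- The number of letters that decrease the coordinate `x 0`. -/
def count0 {n : ℕ} (W : List (Fin 3 × Fin n)) : ℕ := W.countP (·.1 ≠ 0)

/-- The number of letters that increase the coordinate `x 2`. -/
def count2 {n : ℕ} (W : List (Fin 3 × Fin n)) : ℕ := W.countP (·.1 ≠ 2)

section counts
variable {n : ℕ} (A B : List (Fin 3 × Fin n)) (y : Fin 3 × Fin n)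

@[simp] theorem count0_nil : count0 ([] : List (Fin 3 × Fin n)) = 0 := rfl
@[simp] theorem count2_nil : count2 ([] : List (Fin 3 × Fin n)) = 0 := rfl
@[simp] theorem count0_cons : count0 (y :: B) = (if y.1 = 0 then 0 else 1) + count0 B := by
  simp [count0, List.countP_cons, add_comm]
@[simp] theorem count2_cons : count2 (y :: B) = (if y.1 = 2 then 0 else 1) + count2 B := by
  simp [count2, List.countP_cons, add_comm]
@[simp] theorem count0_append : count0 (A ++ B) = count0 A + count0 B := List.countP_append
@[simp] theorem count2_append : count2 (A ++ B) = count2 A + count2 B := List.countP_append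

end counts

/-- The path `W` passes through the vertex with `x 0 = x` and `x 2 = z`. -/
def IsVertex {n : ℕ} (W : List (Fin 3 × Fin n)) (x z : ℕ) : Prop :=
  ∃ A B, W = A ++ B ∧ x = count0 B ∧ z = count2 A

/-- The edge of the path `W` with the letter `l` has the base with `x 0 = x` and `x 2 = z`. -/
def IsEdge {n : ℕ} (W : List (Fin 3 × Fin n)) (l : Fin 3 × Fin n) (x z : ℕ) : Prop :=
  ∃ A B, W = A ++ l :: B ∧ x = count0 B ∧ z = count2 A

/-- The coordinate `x 0` vanishes at the right end and is counted from there, `x 2` from the left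
end. A new first letter thus shifts only `z` for the old vertices. -/
theorem isVertex_cons {n : ℕ} {y : Fin 3 × Fin n} {B : List (Fin 3 × Fin n)} {x z : ℕ} :
    IsVertex (y :: B) x z ↔ (x = count0 (y :: B) ∧ z = 0) ∨
      ∃ z', IsVertex B x z' ∧ z = (if y.1 = 2 then 0 else 1) + z' := by
  constructor
  · rintro ⟨A, C, h, rfl, rfl⟩
    cases A with
    | nil => left; simp_all
    | cons a A =>
      obtain ⟨rfl, rfl⟩ := List.cons.inj h
      exact .inr ⟨_, ⟨A, C, rfl, rfl, rfl⟩, by simp⟩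
  · rintro (⟨rfl, rfl⟩ | ⟨z', ⟨A, C, rfl, rfl, rfl⟩, rfl⟩)
    · exact ⟨[], _, rfl, rfl, rfl⟩
    · exact ⟨y :: A, C, rfl, rfl, by simp⟩

theorem IsVertex.start {n : ℕ} (B : List (Fin 3 × Fin n)) : IsVertex B (count0 B) 0 :=
  ⟨[], B, rfl, rfl, rfl⟩

theorem IsVertex.finish {n : ℕ} (A : List (Fin 3 × Fin n)) : IsVertex A 0 (count2 A) :=
  ⟨A, [], by simp, rfl, rfl⟩

theorem IsVertex.le {n : ℕ} {W : List (Fin 3 × Fin n)} {x z : ℕ} (h : IsVertex W x z) :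
    x ≤ count0 W ∧ z ≤ count2 W := by
  obtain ⟨A, B, rfl, rfl, rfl⟩ := h
  simp

theorem isVertex_append {n : ℕ} {A B : List (Fin 3 × Fin n)} {x z : ℕ} :
    IsVertex (A ++ B) x z ↔ (∃ x', IsVertex A x' z ∧ x = x' + count0 B) ∨
      ∃ z', IsVertex B x z' ∧ z = count2 A + z' := by
  constructor
  · rintro ⟨C, D, h, rfl, rfl⟩
    rcases List.append_eq_append_iff.1 h with ⟨E, rfl, rfl⟩ | ⟨E, rfl, rfl⟩
    · exact .inr ⟨_, ⟨E, D, rfl, rfl, rfl⟩, by simp⟩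
    · exact .inl ⟨_, ⟨C, E, rfl, rfl, rfl⟩, by simp⟩
  · rintro (⟨x', ⟨C, D, rfl, rfl, rfl⟩, rfl⟩ | ⟨z', ⟨C, D, rfl, rfl, rfl⟩, rfl⟩)
    · exact ⟨C, D ++ B, by simp, by simp, rfl⟩
    · exact ⟨A ++ C, D, by simp, rfl, by simp⟩

theorem isEdge_cons {n : ℕ} {y l : Fin 3 × Fin n} {B : List (Fin 3 × Fin n)} {x z : ℕ} :
    IsEdge (y :: B) l x z ↔ (l = y ∧ x = count0 B ∧ z = 0) ∨
      ∃ z', IsEdge B l x z' ∧ z = (if y.1 = 2 then 0 else 1) + z' := by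
  constructor
  · rintro ⟨A, C, h, rfl, rfl⟩
    cases A with
    | nil =>
      obtain ⟨rfl, rfl⟩ := List.cons.inj h
      left; simp
    | cons a A =>
      obtain ⟨rfl, rfl⟩ := List.cons.inj h
      exact .inr ⟨_, ⟨A, C, rfl, rfl, rfl⟩, by simp⟩
  · rintro (⟨rfl, rfl, rfl⟩ | ⟨z', ⟨A, C, rfl, rfl, rfl⟩, rfl⟩)
    · exact ⟨[], _, rfl, rfl, rfl⟩
    · exact ⟨y :: A, C, rfl, rfl, by simp⟩

theorem isEdge_append {n : ℕ} {A B : List (Fin 3 × Fin n)} {l : Fin 3 × Fin n} {x z : ℕ} :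
    IsEdge (A ++ B) l x z ↔ (∃ x', IsEdge A l x' z ∧ x = x' + count0 B) ∨
      ∃ z', IsEdge B l x z' ∧ z = count2 A + z' := by
  constructor
  · rintro ⟨C, D, h, rfl, rfl⟩
    rcases List.append_eq_append_iff.1 h with ⟨E, rfl, h2⟩ | ⟨E, rfl, h2⟩
    · exact .inr ⟨_, ⟨E, D, h2, rfl, rfl⟩, by simp⟩
    · cases E with
      | nil => exact .inr ⟨_, ⟨[], D, h2.symm, rfl, rfl⟩, by simp⟩
      | cons e E =>
        obtain ⟨rfl, rfl⟩ := List.cons.inj h2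
        exact .inl ⟨_, ⟨C, E, rfl, rfl, rfl⟩, by simp⟩
  · rintro (⟨x', ⟨C, D, rfl, rfl, rfl⟩, rfl⟩ | ⟨z', ⟨C, D, rfl, rfl, rfl⟩, rfl⟩)
    · exact ⟨C, D ++ B, by simp, by simp, rfl⟩
    · exact ⟨A ++ C, D, by simp, rfl, by simp⟩

/-! ### Tiling the region below the path -/

/-- The unit triangles below the path `W`. -/
def Below {n : ℕ} (W : List (Fin 3 × Fin n)) : UnitTriangle → Prop
  | .up q => ∃ x z, IsVertex W x z ∧ x ≤ q 0 ∧ z ≤ q 2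
  | .down r => ∀ x z, IsVertex W x z → ¬ (r 0 < x ∧ r 2 < z)

/-- The point of coordinate sum `m` with `x 0 = x` and `x 2 = z`. -/
def pt (m x z : ℕ) : Fin 3 → ℕ := ![x, m - x - z, z]

theorem eq_pt_iff {m x z : ℕ} {q : Fin 3 → ℕ} (h : x + z ≤ m) :
    q = pt m x z ↔ ∑ a, q a = m ∧ q 0 = x ∧ q 2 = z := by
  rw [Fin.sum_univ_three]
  constructor
  · rintro rfl
    simp [pt]
    omega
  · rintro ⟨h1, h2, h3⟩
    funext a
    fin_cases a <;> simp [pt] <;> omega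

theorem pt_add_w {m x z : ℕ} (h : x + z ≤ m) (c : Fin 3) :
    pt m x z + w c = pt (m + 1) (x + w c 0) (z + w c 2) := by
  funext a
  fin_cases c <;> fin_cases a <;> simp [pt, w_apply] <;> omega

/-- The tiles in `S` cover exactly the unit triangles below the path `W`. -/
structure SweepCovers {n : ℕ} (W : List (Fin 3 × Fin n)) (S : Set Tile) : Prop where
  inside : ∀ t ∈ S, ∀ c ∈ t.cells, c.Inside n
  disjoint : ∀ t ∈ S, ∀ t' ∈ S, ∀ c, c ∈ t.cells → c ∈ t'.cells → t = t'
  covered : ∀ c, c.Inside n → ((∃ t ∈ S, c ∈ t.cells) ↔ Below W c)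
  vertex_le : ∀ x z, IsVertex W x z → x + z ≤ n

theorem SweepCovers.insert_tile {n : ℕ} {W W' : List (Fin 3 × Fin n)} {S : Set Tile}
    (h : SweepCovers W S) (t : Tile) (ht : ∀ c ∈ t.cells, c.Inside n ∧ ¬ Below W c)
    (hW : ∀ c, c.Inside n → (Below W' c ↔ Below W c ∨ c ∈ t.cells))
    (hle : ∀ x z, IsVertex W' x z → x + z ≤ n) : SweepCovers W' (insert t S) where
  inside := by
    rintro t' (rfl | ht') c hc
    · exact (ht c hc).1
    · exact h.inside t' ht' c hc
  disjoint := by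
    rintro t' (rfl | ht') t'' (rfl | ht'') c hc hc'
    · rfl
    · exact ((ht c hc).2 ((h.covered c (ht c hc).1).1 ⟨t'', ht'', hc'⟩)).elim
    · exact ((ht c hc').2 ((h.covered c (ht c hc').1).1 ⟨t', ht', hc⟩)).elim
    · exact h.disjoint t' ht' t'' ht'' c hc hc'
  covered := by
    intro c hc
    rw [hW c hc, ← h.covered c hc]
    constructor
    · rintro ⟨t', rfl | ht', hct⟩
      · exact .inr hct
      · exact .inl ⟨t', ht', hct⟩
    · rintro (⟨t', ht', hct⟩ | hct)
      · exact ⟨t', .inr ht', hct⟩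
      · exact ⟨t, .inl rfl, hct⟩
  vertex_le := hle

/-- The index in `Fin 3` different from `a` and `b`. -/
def third (a b : Fin 3) : Fin 3 := -(a + b)

/-- A rhombus with sides of kinds `a` and `b` has its short diagonal of the third kind. The
equations locate the middle vertex of the path after the exchange. -/
theorem third_spec {a b : Fin 3} (hab : a < b) :
    third a b ≠ a ∧ third a b ≠ b ∧ a ≠ 2 ∧ b ≠ 0 ∧
      (if a = 0 then 0 else 1) = w (third a b) 0 ∧
      (if b = 2 then 0 else 1) = w (third a b) 2 ∧ w (third a b) 0 + w (third a b) 2 ≤ 1 := by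
  revert a b
  simp only [w_apply]
  decide

theorem isVertex_insert {n : ℕ} (A B : List (Fin 3 × Fin n)) (y : Fin 3 × Fin n) (x z : ℕ) :
    IsVertex (A ++ y :: B) x z ↔
      (∃ x', IsVertex A x' z ∧ x = x' + ((if y.1 = 0 then 0 else 1) + count0 B)) ∨
      (∃ z', IsVertex B x z' ∧ z = count2 A + (if y.1 = 2 then 0 else 1) + z') := by
  simp only [isVertex_append, isVertex_cons, count0_cons]
  constructor
  · rintro (h | ⟨z', ⟨rfl, rfl⟩ | ⟨z', h, rfl⟩, rfl⟩)
    · exact .inl h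
    · exact .inl ⟨0, .finish A, by simp⟩
    · exact .inr ⟨z', h, by omega⟩
  · rintro (h | ⟨z', h, rfl⟩)
    · exact .inl h
    · exact .inr ⟨_, .inr ⟨z', h, rfl⟩, by omega⟩

/-- The outer vertices belong to `A` and `B`, so exchanging the two letters affects only the middle
case. -/
theorem isVertex_pair {n : ℕ} (A B : List (Fin 3 × Fin n)) (y y' : Fin 3 × Fin n) (x z : ℕ) :
    IsVertex (A ++ y :: y' :: B) x z ↔
      (∃ x', IsVertex A x' z ∧
        x = x' + ((if y.1 = 0 then 0 else 1) + (if y'.1 = 0 then 0 else 1) + count0 B)) ∨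
      (x = (if y'.1 = 0 then 0 else 1) + count0 B ∧
        z = count2 A + (if y.1 = 2 then 0 else 1)) ∨
      (∃ z', IsVertex B x z' ∧
        z = count2 A + ((if y.1 = 2 then 0 else 1) + (if y'.1 = 2 then 0 else 1)) + z') := by
  simp only [isVertex_insert, isVertex_cons, count0_cons]
  constructor
  · rintro (⟨x', h, rfl⟩ | ⟨z', ⟨rfl, rfl⟩ | ⟨z', h, rfl⟩, rfl⟩)
    · exact .inl ⟨x', h, by omega⟩
    · exact .inr (.inl ⟨rfl, rfl⟩)
    · exact .inr (.inr ⟨z', h, by omega⟩)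
  · rintro (⟨x', h, rfl⟩ | ⟨rfl, rfl⟩ | ⟨z', h, rfl⟩)
    · exact .inl ⟨x', h, by omega⟩
    · exact .inr ⟨0, .inl ⟨rfl, rfl⟩, rfl⟩
    · exact .inr ⟨_, .inr ⟨z', h, rfl⟩, by omega⟩

/-- The middle vertex is the bottom corner of the downward cell before the exchange and the apex of
the upward cell after it. `Below` tests exactly these corners, so only the two cells of the rhombus
change status. -/
theorem SweepCovers.add_rhombus {n : ℕ} {A B : List (Fin 3 × Fin n)} {a b : Fin 3} {i j : Fin n}
    {S : Set Tile} (hab : a < b) (h : SweepCovers (A ++ (a, i) :: (b, j) :: B) S) :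
    SweepCovers (A ++ (b, j) :: (a, i) :: B)
      (insert (Tile.rhombus (pt (n - 2) (count0 B) (count2 A)) (third a b)) S) := by
  obtain ⟨-, -, ha, hb, hκ, hl, hle⟩ := third_spec hab
  have hV := isVertex_pair A B (a, i) (b, j)
  have hV' := isVertex_pair A B (b, j) (a, i)
  have hA : ∀ x z, IsVertex A x z → z ≤ count2 A := fun x z h => h.le.2
  have hB : ∀ x z, IsVertex B x z → x ≤ count0 B := fun x z h => h.le.1
  have hA0 := IsVertex.finish A
  have hB0 := IsVertex.start B
  simp only [ha, hb, hκ, hl, if_false] at hV hV'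
  have hmid := h.vertex_le _ _ ((hV _ _).2 (.inr (.inl ⟨rfl, rfl⟩)))
  have hpt : count0 B + count2 A ≤ n - 2 := by omega
  -- By `hmid`, `2 ≤ n`, so no subtraction is truncated.
  have hn : n - 2 + 1 = n - 1 := by omega
  refine h.insert_tile _ ?_ ?_ ?_
  · rintro c (rfl | rfl)
    · have := (eq_pt_iff hpt).1 rfl
      refine ⟨by simp only [UnitTriangle.Inside]; omega, fun hc => ?_⟩
      exact hc _ _ ((hV _ _).2 (.inr (.inl ⟨rfl, rfl⟩))) (by omega)
    · rw [pt_add_w hpt, hn]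
      have := (eq_pt_iff (m := n - 1) (x := count0 B + w (third a b) 0)
        (z := count2 A + w (third a b) 2) (by omega)).1 rfl
      refine ⟨by simp only [UnitTriangle.Inside]; omega, ?_⟩
      rintro ⟨x, z, hxz, hx, hz⟩
      rcases (hV _ _).1 hxz with ⟨x', hx', rfl⟩ | ⟨rfl, rfl⟩ | ⟨z', hz', rfl⟩ <;> omega
  · rintro (q | r) hc
    · have hq : UnitTriangle.up q ∈ (Tile.rhombus (pt (n - 2) (count0 B) (count2 A))
          (third a b)).cells ↔ q 0 = count0 B + w (third a b) 0 ∧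
            q 2 = count2 A + w (third a b) 2 := by
        simp only [UnitTriangle.Inside] at hc
        simp only [Tile.cells, Set.mem_insert_iff, Set.mem_singleton_iff, reduceCtorEq, false_or,
          UnitTriangle.up.injEq]
        rw [pt_add_w hpt, hn, eq_pt_iff (by omega)]
        constructor
        · exact fun h => h.2
        · exact fun h => ⟨by omega, h⟩
      rw [hq]
      constructor
      · rintro ⟨x, z, hxz, hx, hz⟩
        rcases (hV' _ _).1 hxz with h' | ⟨rfl, rfl⟩ | h'
        · exact .inl ⟨x, z, (hV _ _).2 (.inl (by simpa [add_comm] using h')), hx, hz⟩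
        · by_cases h0 : q 0 = count0 B + w (third a b) 0
          · by_cases h2 : q 2 = count2 A + w (third a b) 2
            · exact .inr ⟨h0, h2⟩
            · exact .inl ⟨_, _, (hV _ _).2 (.inr (.inr ⟨_, hB0, rfl⟩)), by omega, by omega⟩
          · exact .inl ⟨_, _, (hV _ _).2 (.inl ⟨_, hA0, rfl⟩), by omega, by omega⟩
        · exact .inl ⟨x, z, (hV _ _).2 (.inr (.inr (by simpa [add_comm] using h'))), hx, hz⟩
      · rintro (⟨x, z, hxz, hx, hz⟩ | ⟨h0, h2⟩)
        · rcases (hV _ _).1 hxz with h' | ⟨rfl, rfl⟩ | h'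
          · exact ⟨x, z, (hV' _ _).2 (.inl (by simpa [add_comm] using h')), hx, hz⟩
          · exact ⟨_, _, (hV' _ _).2 (.inr (.inl ⟨rfl, rfl⟩)), by omega, by omega⟩
          · exact ⟨x, z, (hV' _ _).2 (.inr (.inr (by simpa [add_comm] using h'))), hx, hz⟩
        · exact ⟨_, _, (hV' _ _).2 (.inr (.inl ⟨rfl, rfl⟩)), by omega, by omega⟩
    · have hr : UnitTriangle.down r ∈ (Tile.rhombus (pt (n - 2) (count0 B) (count2 A))
          (third a b)).cells ↔ r 0 = count0 B ∧ r 2 = count2 A := by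
        simp only [UnitTriangle.Inside] at hc
        simp only [Tile.cells, Set.mem_insert_iff, Set.mem_singleton_iff, reduceCtorEq, or_false,
          UnitTriangle.down.injEq]
        rw [eq_pt_iff hpt]
        constructor
        · exact fun h => h.2
        · exact fun h => ⟨by omega, h⟩
      rw [hr]
      constructor
      · intro h'
        have h1 := h' _ _ ((hV' _ _).2 (.inl ⟨_, hA0, rfl⟩))
        have h2 := h' _ _ ((hV' _ _).2 (.inr (.inr ⟨_, hB0, rfl⟩)))
        by_cases hrr : r 0 = count0 B ∧ r 2 = count2 A
        · exact .inr hrr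
        · left
          intro x z hxz
          rcases (hV _ _).1 hxz with h3 | ⟨rfl, rfl⟩ | h3
          · exact h' x z ((hV' _ _).2 (.inl (by simpa [add_comm] using h3)))
          · omega
          · exact h' x z ((hV' _ _).2 (.inr (.inr (by simpa [add_comm] using h3))))
      · rintro (h' | ⟨h0, h2⟩) x z hxz
        · rcases (hV' _ _).1 hxz with h3 | ⟨rfl, rfl⟩ | h3
          · exact h' x z ((hV _ _).2 (.inl (by simpa [add_comm] using h3)))
          · have := h' _ _ ((hV _ _).2 (.inr (.inl ⟨rfl, rfl⟩)))
            omega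
          · exact h' x z ((hV _ _).2 (.inr (.inr (by simpa [add_comm] using h3))))
        · rcases (hV' _ _).1 hxz with ⟨x', h3, rfl⟩ | ⟨rfl, rfl⟩ | ⟨z', h3, rfl⟩
          · have := hA _ _ h3
            omega
          · omega
          · have := hB _ _ h3
            omega
  · intro x z hxz
    rcases (hV' _ _).1 hxz with h3 | ⟨rfl, rfl⟩ | h3
    · exact h.vertex_le x z ((hV _ _).2 (.inl (by simpa [add_comm] using h3)))
    · omega
    · exact h.vertex_le x z ((hV _ _).2 (.inr (.inr (by simpa [add_comm] using h3))))

theorem SweepCovers.add_triangle {n : ℕ} {A B : List (Fin 3 × Fin n)} {i : Fin n}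
    {S : Set Tile} (h : SweepCovers (A ++ (1, i) :: B) S) :
    SweepCovers (A ++ (2, i) :: (0, i) :: B)
      (insert (Tile.triangle (pt (n - 1) (count0 B) (count2 A))) S) := by
  have hV := isVertex_insert A B (1, i)
  have hV' := isVertex_pair A B (2, i) (0, i)
  have hA : ∀ x z, IsVertex A x z → z ≤ count2 A := fun x z h => h.le.2
  have hB : ∀ x z, IsVertex B x z → x ≤ count0 B := fun x z h => h.le.1
  have hA0 := IsVertex.finish A
  have hB0 := IsVertex.start B
  simp at hV hV'
  have hmid := h.vertex_le _ _ ((hV _ _).2 (.inl ⟨_, hA0, rfl⟩))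
  have hpt : count0 B + count2 A ≤ n - 1 := by omega
  refine h.insert_tile _ ?_ ?_ ?_
  · rintro c rfl
    have := (eq_pt_iff hpt).1 rfl
    refine ⟨by simp only [UnitTriangle.Inside]; omega, ?_⟩
    rintro ⟨x, z, hxz, hx, hz⟩
    rcases (hV _ _).1 hxz with ⟨x', hx', rfl⟩ | ⟨z', hz', rfl⟩ <;> omega
  · rintro (q | r) hc
    · have hq : UnitTriangle.up q ∈ (Tile.triangle (pt (n - 1) (count0 B) (count2 A))).cells ↔
          q 0 = count0 B ∧ q 2 = count2 A := by
        simp only [UnitTriangle.Inside] at hc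
        simp only [Tile.cells, Set.mem_singleton_iff, UnitTriangle.up.injEq]
        rw [eq_pt_iff hpt]
        constructor
        · exact fun h => h.2
        · exact fun h => ⟨by omega, h⟩
      rw [hq]
      constructor
      · rintro ⟨x, z, hxz, hx, hz⟩
        rcases (hV' _ _).1 hxz with h' | ⟨rfl, rfl⟩ | h'
        · exact .inl ⟨x, z, (hV _ _).2 (.inl h'), hx, hz⟩
        · by_cases h0 : q 0 = count0 B
          · by_cases h2 : q 2 = count2 A
            · exact .inr ⟨h0, h2⟩
            · exact .inl ⟨_, _, (hV _ _).2 (.inr ⟨_, hB0, rfl⟩), by omega, by omega⟩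
          · exact .inl ⟨_, _, (hV _ _).2 (.inl ⟨_, hA0, rfl⟩), by omega, by omega⟩
        · exact .inl ⟨x, z, (hV _ _).2 (.inr h'), hx, hz⟩
      · rintro (⟨x, z, hxz, hx, hz⟩ | ⟨h0, h2⟩)
        · rcases (hV _ _).1 hxz with h' | h'
          · exact ⟨x, z, (hV' _ _).2 (.inl h'), hx, hz⟩
          · exact ⟨x, z, (hV' _ _).2 (.inr (.inr h')), hx, hz⟩
        · exact ⟨_, _, (hV' _ _).2 (.inr (.inl ⟨rfl, rfl⟩)), by omega, by omega⟩
    · simp only [Tile.cells, Set.mem_singleton_iff, reduceCtorEq, or_false]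
      constructor
      · intro h' x z hxz
        rcases (hV _ _).1 hxz with h3 | h3
        · exact h' x z ((hV' _ _).2 (.inl h3))
        · exact h' x z ((hV' _ _).2 (.inr (.inr h3)))
      · intro h' x z hxz
        rcases (hV' _ _).1 hxz with h3 | ⟨rfl, rfl⟩ | h3
        · exact h' x z ((hV _ _).2 (.inl h3))
        -- The new apex excludes no further downward cell: the left end of the split step already
        -- has coordinates at least as large.
        · have := h' _ _ ((hV _ _).2 (.inl ⟨_, hA0, rfl⟩))
          omega
        · exact h' x z ((hV _ _).2 (.inr h3))
  · intro x z hxz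
    rcases (hV' _ _).1 hxz with h3 | ⟨rfl, rfl⟩ | h3
    · exact h.vertex_le x z ((hV _ _).2 (.inl h3))
    · omega
    · exact h.vertex_le x z ((hV _ _).2 (.inr h3))

/-! ### Carrying the colors along the sweep -/

theorem isEdge_pair {n : ℕ} (A B : List (Fin 3 × Fin n)) (y y' l : Fin 3 × Fin n) (x z : ℕ) :
    IsEdge (A ++ y :: y' :: B) l x z ↔
      (∃ x', IsEdge A l x' z ∧
        x = x' + ((if y.1 = 0 then 0 else 1) + (if y'.1 = 0 then 0 else 1) + count0 B)) ∨
      (l = y ∧ x = (if y'.1 = 0 then 0 else 1) + count0 B ∧ z = count2 A) ∨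
      (l = y' ∧ x = count0 B ∧ z = count2 A + (if y.1 = 2 then 0 else 1)) ∨
      (∃ z', IsEdge B l x z' ∧
        z = count2 A + ((if y.1 = 2 then 0 else 1) + (if y'.1 = 2 then 0 else 1)) + z') := by
  simp only [isEdge_append, isEdge_cons, count0_cons]
  constructor
  · rintro (⟨x', h, rfl⟩ | ⟨z', ⟨rfl, rfl, rfl⟩ | ⟨z', ⟨rfl, rfl, rfl⟩ | ⟨z', h, rfl⟩, rfl⟩, rfl⟩)
    · exact .inl ⟨x', h, by omega⟩
    · exact .inr (.inl ⟨rfl, rfl, rfl⟩)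
    · exact .inr (.inr (.inl ⟨rfl, rfl, rfl⟩))
    · exact .inr (.inr (.inr ⟨z', h, by omega⟩))
  · rintro (⟨x', h, rfl⟩ | ⟨rfl, rfl, rfl⟩ | ⟨rfl, rfl, rfl⟩ | ⟨z', h, rfl⟩)
    · exact .inl ⟨x', h, by omega⟩
    · exact .inr ⟨0, .inl ⟨rfl, rfl, rfl⟩, rfl⟩
    · exact .inr ⟨_, .inr ⟨_, .inl ⟨rfl, rfl, rfl⟩, rfl⟩, rfl⟩
    · exact .inr ⟨_, .inr ⟨_, .inr ⟨z', h, rfl⟩, rfl⟩, by omega⟩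

theorem isEdge_single {n : ℕ} (A B : List (Fin 3 × Fin n)) (y l : Fin 3 × Fin n) (x z : ℕ) :
    IsEdge (A ++ y :: B) l x z ↔
      (∃ x', IsEdge A l x' z ∧ x = x' + ((if y.1 = 0 then 0 else 1) + count0 B)) ∨
      (l = y ∧ x = count0 B ∧ z = count2 A) ∨
      (∃ z', IsEdge B l x z' ∧ z = count2 A + (if y.1 = 2 then 0 else 1) + z') := by
  simp only [isEdge_append, isEdge_cons, count0_cons]
  constructor
  · rintro (h | ⟨z', ⟨rfl, rfl, rfl⟩ | ⟨z', h, rfl⟩, rfl⟩)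
    · exact .inl h
    · exact .inr (.inl ⟨rfl, rfl, rfl⟩)
    · exact .inr (.inr ⟨z', h, by omega⟩)
  · rintro (h | ⟨rfl, rfl, rfl⟩ | ⟨z', h, rfl⟩)
    · exact .inl h
    · exact .inr ⟨0, .inl ⟨rfl, rfl, rfl⟩, rfl⟩
    · exact .inr ⟨_, .inr ⟨z', h, rfl⟩, by omega⟩

/-- The edges `e` and `f` are joined by a strip of rhombi from `S`. -/
def Joined (S : Set Tile) : Edge → Edge → Prop :=
  Relation.ReflTransGen fun e f => ∃ t ∈ S, t.Opposite e f

theorem Joined.mono {S S' : Set Tile} (h : S ⊆ S') {e f : Edge} (hef : Joined S e f) :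
    Joined S' e f :=
  Relation.ReflTransGen.mono (fun _ _ ⟨t, ht, hab⟩ => ⟨t, h ht, hab⟩) _ _ hef

theorem Tile.Opposite.symm {t : Tile} {e f : Edge} (h : t.Opposite e f) : t.Opposite f e := by
  cases t with
  | triangle q => exact h
  | rhombus r a =>
    obtain ⟨b, hb, ⟨rfl, rfl⟩ | ⟨rfl, rfl⟩⟩ := h
    · exact ⟨b, hb, .inr ⟨rfl, rfl⟩⟩
    · exact ⟨b, hb, .inl ⟨rfl, rfl⟩⟩

theorem LozengeTiling.HasColor.joined {n : ℕ} {T : LozengeTiling n} {ν : T.Numbering} {e f : Edge}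
    {i : Fin n} (h : T.HasColor ν e i) (hef : Joined T.tiles e f) : T.HasColor ν f i := by
  induction hef with
  | refl => exact h
  | tail _ hef ih =>
    obtain ⟨t, ht, hto⟩ := hef
    exact .spread ht hto ih

/-- The triangles in `S` are numbered by the relation `C`, and the letters of the path `W` and the
edges `β i` at the bottom are joined to the triangles, or to each other, accordingly. -/
structure SweepColors {n : ℕ} (β : Fin n → Edge) (W : List (Fin 3 × Fin n)) (S : Set Tile)
    (C : Fin n → (Fin 3 → ℕ) → Prop) : Prop where
  nodup : (rightColors W).Nodup
  mem : ∀ i p, C i p → Tile.triangle p ∈ S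
  exists_color : ∀ p, Tile.triangle p ∈ S → ∃ i, C i p
  color_unique : ∀ i j p, C i p → C j p → i = j
  triangle_unique : ∀ i p p', C i p → C i p' → p = p'
  born : ∀ i, (1, i) ∈ W ∨ ∃ p, C i p
  unborn : ∀ i p, (1, i) ∈ W → ¬ C i p
  side : ∀ b i x z, IsEdge W (b, i) x z → b ≠ 1 →
    ∃ p, C i p ∧ Joined S ⟨p, b⟩ ⟨pt (n - 1) x z, b⟩
  bottom : ∀ i x z, IsEdge W (1, i) x z → Joined S ⟨pt (n - 1) x z, 1⟩ (β i)
  base : ∀ i p, C i p → Joined S ⟨p, 1⟩ (β i)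

/-- In each pair the first edge is the step before the exchange and the second the step of the same
kind after it. -/
theorem rhombus_opposite {m x z : ℕ} {a b : Fin 3} (hab : a < b) (h : x + z ≤ m) :
    (Tile.rhombus (pt m x z) (third a b)).Opposite ⟨pt (m + 1) (1 + x) z, a⟩
        ⟨pt (m + 1) x (z + w (third a b) 2), a⟩ ∧
      (Tile.rhombus (pt m x z) (third a b)).Opposite ⟨pt (m + 1) x (z + 1), b⟩
        ⟨pt (m + 1) (w (third a b) 0 + x) z, b⟩ := by
  obtain ⟨ha, hb, -⟩ := third_spec hab
  refine ⟨⟨a, ha.symm, ?_⟩, ⟨b, hb.symm, ?_⟩⟩ <;>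
  · simp only [pt_add_w h, Edge.mk.injEq, and_true]
    clear ha hb
    revert a b
    intro a b hab
    fin_cases a <;> fin_cases b <;> simp [third, w_apply, add_comm,
      show (-1 : Fin 3) = 2 from rfl, show (-2 : Fin 3) = 1 from rfl] at hab ⊢

theorem SweepColors.add_rhombus {n : ℕ} {β : Fin n → Edge} {A B : List (Fin 3 × Fin n)}
    {a b : Fin 3} {i j : Fin n} {S : Set Tile} {C : Fin n → (Fin 3 → ℕ) → Prop} (hab : a < b)
    (h : SweepColors β (A ++ (a, i) :: (b, j) :: B) S C) (hn : count0 B + count2 A + 2 ≤ n) :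
    SweepColors β (A ++ (b, j) :: (a, i) :: B)
      (insert (Tile.rhombus (pt (n - 2) (count0 B) (count2 A)) (third a b)) S) C := by
  obtain ⟨-, -, ha, hb, hκ, hl, -⟩ := third_spec hab
  have hE := isEdge_pair A B (a, i) (b, j)
  have hE' := isEdge_pair A B (b, j) (a, i)
  simp only [ha, hb, hκ, hl, if_false] at hE hE'
  obtain ⟨hoa, hob⟩ := rhombus_opposite hab (show count0 B + count2 A ≤ n - 2 by omega)
  rw [show n - 2 + 1 = n - 1 by omega] at hoa hob
  set t := Tile.rhombus (pt (n - 2) (count0 B) (count2 A)) (third a b) with ht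
  have hsub : S ⊆ insert t S := Set.subset_insert _ _
  have hperm := List.Perm.append_left A (List.Perm.swap (a, i) (b, j) B)
  -- Every new step is an old step with the same letter, possibly carried across the new rhombus.
  have hedge : ∀ c k x z, IsEdge (A ++ (b, j) :: (a, i) :: B) (c, k) x z →
      ∃ x' z', IsEdge (A ++ (a, i) :: (b, j) :: B) (c, k) x' z' ∧
        Joined (insert t S) ⟨pt (n - 1) x' z', c⟩ ⟨pt (n - 1) x z, c⟩ ∧
        Joined (insert t S) ⟨pt (n - 1) x z, c⟩ ⟨pt (n - 1) x' z', c⟩ := by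
    intro c k x z hxz
    rcases (hE' _ _ _).1 hxz with h1 | ⟨h1, rfl, rfl⟩ | ⟨h1, rfl, rfl⟩ | h1
    · exact ⟨x, z, (hE _ _ _).2 (.inl (by simpa [add_comm] using h1)), .refl, .refl⟩
    · cases h1
      exact ⟨_, _, (hE _ _ _).2 (.inr (.inr (.inl ⟨rfl, rfl, rfl⟩))),
        .single ⟨t, .inl rfl, hob⟩, .single ⟨t, .inl rfl, hob.symm⟩⟩
    · cases h1
      exact ⟨_, _, (hE _ _ _).2 (.inr (.inl ⟨rfl, rfl, rfl⟩)),
        .single ⟨t, .inl rfl, hoa⟩, .single ⟨t, .inl rfl, hoa.symm⟩⟩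
    · exact ⟨x, z, (hE _ _ _).2 (.inr (.inr (.inr (by simpa [add_comm] using h1)))), .refl, .refl⟩
  refine
    { nodup := (Sweep.rhombus A B i j hab).rightColors_perm.nodup_iff.1 h.nodup
      mem := fun k p hk => .inr (h.mem k p hk)
      exists_color := fun p hp => h.exists_color p (hp.resolve_left (by simp [ht]))
      color_unique := h.color_unique
      triangle_unique := h.triangle_unique
      born := fun k => (h.born k).imp_left hperm.mem_iff.2
      unborn := fun k p hk => h.unborn k p (hperm.mem_iff.1 hk)
      side := ?_
      bottom := ?_
      base := fun k p hk => (h.base k p hk).mono hsub }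
  · intro c k x z hxz hc
    obtain ⟨x', z', h1, h2, -⟩ := hedge c k x z hxz
    obtain ⟨p, hp, hj⟩ := h.side c k x' z' h1 hc
    exact ⟨p, hp, (hj.mono hsub).trans h2⟩
  · intro k x z hxz
    obtain ⟨x', z', h1, -, h2⟩ := hedge 1 k x z hxz
    exact h2.trans ((h.bottom k x' z' h1).mono hsub)

theorem mem_rightColors {n : ℕ} {W : List (Fin 3 × Fin n)} {i : Fin n} (h : (1, i) ∈ W) :
    i ∈ rightColors W := by
  simp only [rightColors, List.mem_map, List.mem_filter]
  exact ⟨(1, i), ⟨h, by simp⟩, rfl⟩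

theorem SweepColors.add_triangle {n : ℕ} {β : Fin n → Edge} {A B : List (Fin 3 × Fin n)}
    {i : Fin n} {S : Set Tile} {C : Fin n → (Fin 3 → ℕ) → Prop}
    (h : SweepColors β (A ++ (1, i) :: B) S C)
    (hq : Tile.triangle (pt (n - 1) (count0 B) (count2 A)) ∉ S) :
    SweepColors β (A ++ (2, i) :: (0, i) :: B)
      (insert (Tile.triangle (pt (n - 1) (count0 B) (count2 A))) S)
      (fun k p => C k p ∨ (k = i ∧ p = pt (n - 1) (count0 B) (count2 A))) := by
  have hE := isEdge_single A B (1, i)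
  have hE' := isEdge_pair A B (2, i) (0, i)
  simp at hE hE'
  set q := pt (n - 1) (count0 B) (count2 A) with hqdef
  have hsub : S ⊆ insert (Tile.triangle q) S := Set.subset_insert _ _
  have hCi : ∀ p, ¬ C i p := fun p => h.unborn i p (by simp)
  have hCq : ∀ k, ¬ C k q := fun k hk => hq (h.mem k q hk)
  have hnd := h.nodup
  -- Colors are not repeated among the steps of kinds 0 and 1, so no horizontal step of color `i`
  -- survives the split.
  have hiAB : (1, i) ∉ A ∧ (1, i) ∉ B := by
    rw [show A ++ (1, i) :: B = A ++ ([(1, i)] ++ B) by simp, rightColors_append,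
      rightColors_append, List.nodup_append, List.nodup_append] at hnd
    obtain ⟨-, ⟨-, -, hB⟩, hA⟩ := hnd
    refine ⟨fun hm => ?_, fun hm => ?_⟩
    · exact hA i (mem_rightColors hm) i
        (List.mem_append_left _ (mem_rightColors (by simp))) rfl
    · exact hB i (mem_rightColors (by simp)) i (mem_rightColors hm) rfl
  constructor
  · exact (Sweep.triangle A B i).rightColors_perm.nodup_iff.1 h.nodup
  · rintro k p (hk | ⟨rfl, rfl⟩)
    · exact .inr (h.mem k p hk)
    · exact .inl rfl
  · rintro p (hp | hp)
    · cases hp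
      exact ⟨i, .inr ⟨rfl, rfl⟩⟩
    · obtain ⟨k, hk⟩ := h.exists_color p hp
      exact ⟨k, .inl hk⟩
  · rintro k l p (hk | ⟨rfl, rfl⟩) (hl | ⟨rfl, hp⟩)
    · exact h.color_unique k l p hk hl
    · exact (hCq k (hp ▸ hk)).elim
    · exact (hCq l hl).elim
    · rfl
  · rintro k p p' (hk | ⟨rfl, rfl⟩) (hl | ⟨h1, rfl⟩)
    · exact h.triangle_unique k p p' hk hl
    · exact (hCi p (h1 ▸ hk)).elim
    · exact (hCi p' hl).elim
    · rfl
  · intro k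
    by_cases hk : k = i
    · exact .inr ⟨q, .inr ⟨hk, rfl⟩⟩
    · refine (h.born k).imp ?_ ?_
      · intro h1
        simpa [hk] using h1
      · rintro ⟨p, hp⟩
        exact ⟨p, .inl hp⟩
  · rintro k p hk (hC | ⟨rfl, rfl⟩)
    · refine h.unborn k p ?_ hC
      simp at hk ⊢
      tauto
    · simp at hk
      tauto
  · intro b k x z hxz hb
    have hold : IsEdge (A ++ (1, i) :: B) (b, k) x z → ∃ p, (C k p ∨ (k = i ∧ p = q)) ∧
        Joined (insert (Tile.triangle q) S) ⟨p, b⟩ ⟨pt (n - 1) x z, b⟩ := by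
      intro h1
      obtain ⟨p, hp, hj⟩ := h.side b k x z h1 hb
      exact ⟨p, .inl hp, hj.mono hsub⟩
    rcases (hE' _ _ _ _).1 hxz with h1 | ⟨⟨rfl, rfl⟩, rfl, rfl⟩ | ⟨⟨rfl, rfl⟩, rfl, rfl⟩ | h1
    · exact hold ((hE _ _ _ _).2 (.inl h1))
    · exact ⟨q, .inr ⟨rfl, rfl⟩, .refl⟩
    · exact ⟨q, .inr ⟨rfl, rfl⟩, .refl⟩
    · exact hold ((hE _ _ _ _).2 (.inr (.inr h1)))
  · intro k x z hxz
    rcases (hE' _ _ _ _).1 hxz with h1 | ⟨⟨h1, -⟩, -⟩ | ⟨⟨h1, -⟩, -⟩ | h1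
    · exact (h.bottom k x z ((hE _ _ _ _).2 (.inl h1))).mono hsub
    · simp at h1
    · simp at h1
    · exact (h.bottom k x z ((hE _ _ _ _).2 (.inr (.inr h1)))).mono hsub
  · rintro k p (hk | ⟨rfl, rfl⟩)
    · exact (h.base k p hk).mono hsub
    · exact (h.bottom k _ _ ((hE _ _ _ _).2 (.inr (.inl ⟨⟨rfl, rfl⟩, rfl, rfl⟩)))).mono hsub

theorem Sweep.exists_tiles {n : ℕ} {β : Fin n → Edge} {W W' : List (Fin 3 × Fin n)}
    (hW : Sweep W W') {S : Set Tile} {C : Fin n → (Fin 3 → ℕ) → Prop}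
    (h1 : SweepCovers W S) (h2 : SweepColors β W S C) :
    ∃ S' C', SweepCovers W' S' ∧ SweepColors β W' S' C' := by
  cases hW with
  | rhombus A B i j hab =>
    refine ⟨_, _, h1.add_rhombus hab, h2.add_rhombus hab ?_⟩
    obtain ⟨-, -, ha, hb, -⟩ := third_spec hab
    have := h1.vertex_le _ _ ((isVertex_pair A B _ _ _ _).2 (.inr (.inl ⟨rfl, rfl⟩)))
    simp only [ha, hb, if_false] at this
    omega
  | triangle A B i =>
    refine ⟨_, _, h1.add_triangle, h2.add_triangle fun hS => ?_⟩
    -- If the tile were already present, some path vertex would lie weakly above its apex, but the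
    -- path runs along its base.
    have hin := h1.inside _ hS _ rfl
    obtain ⟨x, z, hxz, hx, hz⟩ := (h1.covered _ hin).1 ⟨_, hS, rfl⟩
    rw [isVertex_insert] at hxz
    simp [pt] at hx hz hxz
    rcases hxz with ⟨x', -, rfl⟩ | ⟨z', -, rfl⟩ <;> omega

theorem Sweeps.exists_tiles {n : ℕ} {β : Fin n → Edge} {W W' : List (Fin 3 × Fin n)}
    (hW : Sweeps W W') {S : Set Tile} {C : Fin n → (Fin 3 → ℕ) → Prop}
    (h1 : SweepCovers W S) (h2 : SweepColors β W S C) :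
    ∃ S' C', SweepCovers W' S' ∧ SweepColors β W' S' C' := by
  induction hW with
  | refl => exact ⟨S, C, h1, h2⟩
  | tail _ hW ih =>
    obtain ⟨S', C', h1, h2⟩ := ih
    exact hW.exists_tiles h1 h2

/-! ### The initial and final paths -/

theorem count0_map {n : ℕ} (V : List (Fin n)) (b : Fin 3) :
    count0 (V.map (Prod.mk b)) = if b = 0 then 0 else V.length := by
  by_cases hb : b = 0 <;> simp [count0, List.countP_map, Function.comp_def, hb]

theorem count2_map {n : ℕ} (V : List (Fin n)) (b : Fin 3) :
    count2 (V.map (Prod.mk b)) = if b = 2 then 0 else V.length := by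
  by_cases hb : b = 2 <;> simp [count2, List.countP_map, Function.comp_def, hb]

theorem isVertex_map {n : ℕ} (V : List (Fin n)) (b : Fin 3) (x z : ℕ) :
    IsVertex (V.map (Prod.mk b)) x z ↔ ∃ k l, k + l = V.length ∧
      x = (if b = 0 then 0 else l) ∧ z = (if b = 2 then 0 else k) := by
  constructor
  · rintro ⟨A, B, h, rfl, rfl⟩
    obtain ⟨V₁, V₂, rfl, rfl, rfl⟩ := List.map_eq_append_iff.1 h
    exact ⟨V₁.length, V₂.length, by simp, count0_map _ _, count2_map _ _⟩
  · rintro ⟨k, l, h, rfl, rfl⟩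
    refine ⟨(V.take k).map (Prod.mk b), (V.drop k).map (Prod.mk b), ?_, ?_, ?_⟩
    · rw [← List.map_append, List.take_append_drop]
    · rw [count0_map, List.length_drop, show V.length - k = l by omega]
    · rw [count2_map, List.length_take, show min k V.length = k by omega]

theorem isEdge_map_ofFn {n : ℕ} (f : Fin n → Fin n) (b : Fin 3) (k : Fin n) :
    IsEdge ((List.ofFn f).map (Prod.mk b)) (b, f k) (if b = 0 then 0 else n - 1 - k)
      (if b = 2 then 0 else k) := by
  refine ⟨((List.ofFn f).take k).map (Prod.mk b), ((List.ofFn f).drop (k + 1)).map (Prod.mk b),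
    ?_, ?_, ?_⟩
  · have : f k = (List.ofFn f)[(k : ℕ)]'(by simp) := by simp
    rw [this, ← List.map_cons (f := Prod.mk b), ← List.map_append, List.getElem_cons_drop,
      List.take_append_drop]
  · rw [count0_map, List.length_drop, List.length_ofFn, Nat.sub_sub, add_comm 1]
  · rw [count2_map, List.length_take, List.length_ofFn, min_eq_left k.2.le]

theorem sweepCovers_bottom {n : ℕ} (V : List (Fin n)) (hV : V.length = n) :
    SweepCovers (V.map (Prod.mk 1)) ∅ := by
  have hvert := isVertex_map V 1
  simp only [hV, one_ne_zero, if_false, show (1 : Fin 3) ≠ 2 by decide] at hvert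
  refine ⟨by simp, by simp, ?_, ?_⟩
  · rintro (q | r) hc <;>
      simp only [UnitTriangle.Inside, Fin.sum_univ_three] at hc <;>
      simp only [Set.mem_empty_iff_false, false_and, exists_false, false_iff, Below, hvert]
    · rintro ⟨x, z, ⟨k, l, h, rfl, rfl⟩, h1, h2⟩
      omega
    · intro h
      exact h _ _ ⟨r 2 + 1, n - (r 2 + 1), by omega, rfl, rfl⟩ (by omega)
  · intro x z hxz
    obtain ⟨k, l, h, rfl, rfl⟩ := (hvert _ _).1 hxz
    omega

theorem sweepColors_bottom {n : ℕ} (f : Equiv.Perm (Fin n)) :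
    SweepColors (fun i => sideEdge 2 (f.symm i)) ((List.ofFn f).reverse.map (Prod.mk 1)) ∅
      (fun _ _ => False) := by
  constructor
  · rw [rightColors_map _ (by decide), List.nodup_reverse, List.nodup_ofFn]
    exact f.injective
  · simp
  · simp
  · simp
  · simp
  · intro i
    left
    simp [List.mem_ofFn, f.surjective i]
  · simp
  · rintro b i x z ⟨A, B, h, -, -⟩ hb
    have : (b, i) ∈ (List.ofFn f).reverse.map (Prod.mk 1) := by simp [h]
    simp at this
    exact (hb this.1.symm).elim
  · rintro i x z ⟨A, B, h, rfl, rfl⟩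
    obtain ⟨V₁, V₂', h1, rfl, h2⟩ := List.map_eq_append_iff.1 h
    obtain ⟨i', V₂, rfl, h3, rfl⟩ := List.map_eq_cons_iff.1 h2
    cases h3
    have hlen := congrArg List.length h1
    simp at hlen
    -- The word is reversed, so the number of letters after a step is its clockwise position.
    have hf : f ⟨V₂.length, by omega⟩ = i := by
      have h4 := congrArg (fun L => L.reverse[V₂.length]?) h1
      simp only [List.reverse_reverse, List.reverse_append, List.reverse_cons,
        List.append_assoc] at h4
      rw [List.getElem?_append_right (by simp)] at h4
      simpa [show V₂.length < n by omega] using h4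
    have : pt (n - 1) (count0 (V₂.map (Prod.mk 1))) (count2 (V₁.map (Prod.mk 1))) =
        (n - 1 - V₂.length) • w 2 + V₂.length • w 0 := by
      rw [count0_map, count2_map]
      funext a
      fin_cases a <;> simp [pt, w_apply] <;> omega
    rw [this, ← hf]
    simp only [Equiv.symm_apply_apply]
    exact .refl
  · simp

theorem PermSystem.Acyclic.achievable {n : ℕ} {σ : PermSystem n} (h : σ.Acyclic) :
    σ.Achievable := by
  obtain ⟨S, C, h1, h2⟩ := h.sweeps.exists_tiles
    (sweepCovers_bottom _ (by simp)) (sweepColors_bottom (σ 2))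
  -- The final path stays on the left and right sides, so it leaves no downward cell above it.
  have hvert : ∀ x z, IsVertex ((List.ofFn (σ 0)).map (Prod.mk 2) ++
      (List.ofFn (σ 1)).map (Prod.mk 0)) x z → x = 0 ∨ z = 0 := by
    intro x z hxz
    simp only [isVertex_append, isVertex_map, count0_map, count2_map] at hxz
    rcases hxz with ⟨x', ⟨k, l, -, -, rfl⟩, -⟩ | ⟨z', ⟨k, l, -, rfl, -⟩, -⟩ <;> simp
  have htop : IsVertex ((List.ofFn (σ 0)).map (Prod.mk 2) ++
      (List.ofFn (σ 1)).map (Prod.mk 0)) 0 0 :=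
    ⟨_, _, rfl, by rw [count0_map, if_pos rfl], by rw [count2_map, if_pos rfl]⟩
  let T : LozengeTiling n :=
    { tiles := S
      inside := h1.inside
      covers := by
        intro c hc
        have hb : Below ((List.ofFn (σ 0)).map (Prod.mk 2) ++
            (List.ofFn (σ 1)).map (Prod.mk 0)) c := by
          cases c with
          | up q => exact ⟨0, 0, htop, by simp, by simp⟩
          | down r =>
            intro x z hxz
            have := hvert x z hxz
            omega
        obtain ⟨t, ht, hct⟩ := (h1.covered c hc).2 hb
        exact ⟨t, ⟨ht, hct⟩, fun t' ht' => h1.disjoint t' ht'.1 t ht c ht'.2 hct⟩ }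
  have hborn : ∀ i, ∃ p, C i p := by
    intro i
    refine (h2.born i).resolve_left ?_
    simp
  choose p hp using hborn
  let ν : T.Numbering := Equiv.ofBijective (fun i => ⟨p i, h2.mem i _ (hp i)⟩) (by
    constructor
    · intro i j hij
      have hij : p i = p j := congrArg Subtype.val hij
      exact h2.color_unique i j (p i) (hp i) (hij ▸ hp j)
    · rintro ⟨q, hq⟩
      obtain ⟨i, hi⟩ := h2.exists_color q hq
      exact ⟨i, Subtype.ext (h2.triangle_unique i _ _ (hp i) hi)⟩)
  have hside : ∀ b i x z, IsEdge ((List.ofFn (σ 0)).map (Prod.mk 2) ++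
      (List.ofFn (σ 1)).map (Prod.mk 0)) (b, i) x z → b ≠ 1 →
      T.HasColor ν ⟨pt (n - 1) x z, b⟩ i := by
    intro b i x z hxz hb
    obtain ⟨q, hq, hj⟩ := h2.side b i x z hxz hb
    obtain rfl := h2.triangle_unique i _ _ hq (hp i)
    exact (LozengeTiling.HasColor.center (ν := ν) i b).joined hj
  refine ⟨T, ν, fun s k => ?_⟩
  fin_cases s
  · have he : sideEdge 0 k = ⟨pt (n - 1) (n - 1 - k) 0, 2⟩ := by
      simp only [sideEdge, Edge.mk.injEq]
      refine ⟨?_, rfl⟩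
      funext a
      fin_cases a <;> simp [pt, w_apply]
      omega
    change T.HasColor ν (sideEdge 0 k) (σ 0 k)
    rw [he]
    refine hside _ _ _ _ (isEdge_append.2 (.inl ⟨_, isEdge_map_ofFn _ 2 k, ?_⟩)) (by decide)
    rw [count0_map]
    rfl
  · have he : sideEdge 1 k = ⟨pt (n - 1) 0 k, 0⟩ := by
      simp only [sideEdge, Edge.mk.injEq]
      refine ⟨?_, rfl⟩
      funext a
      fin_cases a <;> simp [pt, w_apply]
    change T.HasColor ν (sideEdge 1 k) (σ 1 k)
    rw [he]
    refine hside _ _ _ _ (isEdge_append.2 (.inr ⟨_, isEdge_map_ofFn _ 0 k, ?_⟩)) (by decide)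
    rw [count2_map, if_pos rfl, if_neg (by decide), zero_add]
  -- The final word has no horizontal letter, so the bottom edges are reached from the triangles
  -- through `base`.
  · have := (LozengeTiling.HasColor.center (ν := ν) (σ 2 k) 1).joined (h2.base _ _ (hp _))
    simpa using this

end Lozenge

theorem mainTheorem2 (n : ℕ) (σ : Lozenge.PermSystem n) :
    Lozenge.PermSystem.Achievable σ ↔ Lozenge.PermSystem.Acyclic σ :=
  ⟨fun h => h.acyclic, fun h => h.achievable⟩
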